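/- \textbf{Theorem ($d$-th-order failure risk estimation).} Let $d\ge 1$ and let $\boldsymbol y\sim\mathcal N(\bar{\boldsymbol y},\boldsymbol\Sigma_y)$ be a Gaussian random vector in $\mathbb R^d$, where $\boldsymbol\Sigma_y$ is a symmetric positive semidefinite covariance matrix with $\sigma_i:=\sqrt{(\boldsymbol\Sigma_y)_{i,i}}>0$ for every $i$ (for instance, $\boldsymbol\Sigma_y$ positive definite). Assume $\bar{\boldsymbol y}\preceq\boldsymbol 0$, that is, $\bar y_i\le 0$ for all $i$. Let $r_i=-\bar y_i/\sigma_i$ be the signed Mahalanobis distances, let $\tilde r_1\le\dots\le\tilde r_d$ be the values $r_1,\dots,r_d$ sorted increasingly, and set $\tilde r_0=0$. Let $\Phi_d$ be the cumulative distribution function of the chi-squared distribution with $d$ degrees of freedom, $\Psi_d(r)=1-\Phi_d(r^2)$ for $r\ge0$ and $\Psi_d(r)=1$ for $r<0$, and $\Delta\Psi_d(R_1,R_2)=\Psi_d(R_1)-\Psi_d(R_2)$. For $d\ge2$ and $x\in[0,1]$ let \[ \mathcal I(x)=I_{1-x^2}\!\left(\tfrac{d-1}{2},\tfrac12\right),\qquad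 I_s(a,b)=\frac{1}{B(a,b)}\int_0^{s}t^{a-1}(1-t)^{b-1}\,dt , \] where $B$ is the Euler beta function. Then \[ \beta_{\mathrm T,d}:=1-\sum_{i=1}^{d}\Delta\Psi_d(\tilde r_{i-1},\tilde r_i)\,\max\!\left[0,\;1-\frac12\sum_{j=1}^{i-1}\mathcal I\!\left(\frac{\tilde r_j}{\tilde r_i}\right)\right]\;\ge\;\beta_{\mathrm R}:=1-\mathbb P(\boldsymbol y\preceq\boldsymbol 0). \] (When $\tilde r_i=0$ the $i$-th term is zero, whatever value is given to the quotients $\tilde r_j/\tilde r_i$. When $d=1$ the inner sum is empty.) -/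

import Mathlib

open MeasureTheory ProbabilityTheory

noncomputable section

namespace FailureRisk

/-- The chi-squared distribution with `d` degrees of freedom: the law of the sum of the squares of
`d` independent standard normal variables. -/
def chiSquared (d : ℕ) : Measure ℝ :=
  (Measure.pi (fun _ : Fin d => gaussianReal 0 1)).map (fun z => ∑ i, z i ^ 2)

/-- `Φ_d`, the cumulative distribution function of the chi-squared distribution. -/
def Phi (d : ℕ) (t : ℝ) : ℝ := cdf (chiSquared d) t

/-- `Ψ_d(r) = 1 - Φ_d(r²)` for `r ≥ 0`, and `Ψ_d(r) = 1` for negative `r`. -/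
def Psi (d : ℕ) (r : ℝ) : ℝ := if 0 ≤ r then 1 - Phi d (r ^ 2) else 1

/-- `ΔΨ_d(R₁, R₂) = Ψ_d(R₁) - Ψ_d(R₂)`. -/
def DeltaPsi (d : ℕ) (R₁ R₂ : ℝ) : ℝ := Psi d R₁ - Psi d R₂

/-- The regularized incomplete beta function `I_x(a, b)`, for `a, b > 0` and `0 ≤ x ≤ 1`;
`ProbabilityTheory.beta` is the Euler beta function. -/
def regIncBeta (x a b : ℝ) : ℝ :=
  1 / beta a b * ∫ t in (0 : ℝ)..x, t ^ (a - 1) * (1 - t) ^ (b - 1)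

/-- `ℐ(x) = I_{1 - x²}((d - 1)/2, 1/2)`. For `d ≥ 2` and `0 ≤ θ ≤ π/2`, `ℐ(cos θ) / 2` is the
fraction of the volume of a `d`-dimensional ball that lies in a spherical sector of half-angle
`θ`. -/
def sectorI (d : ℕ) (x : ℝ) : ℝ := regIncBeta (1 - x ^ 2) (((d : ℝ) - 1) / 2) (1 / 2)

/-- The signed Mahalanobis distances `r_i = -ȳ_i / σ_i`, with `σ_i = √Σ_{i,i}`. -/
def signedDist {d : ℕ} (ybar : EuclideanSpace ℝ (Fin d)) (S : Matrix (Fin d) (Fin d) ℝ)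
    (i : Fin d) : ℝ :=
  -ybar i / Real.sqrt (S i i)

/-- The increasing rearrangement `r̃_1 ≤ ⋯ ≤ r̃_d` of `r`, numbered from `1`, with the convention
`r̃_0 = 0`. (Indices above `d` are never used.) -/
def sorted {d : ℕ} (r : Fin d → ℝ) (i : ℕ) : ℝ :=
  if h : 1 ≤ i ∧ i ≤ d then r (Tuple.sort r ⟨i - 1, by omega⟩) else 0

/-- The `d`-th order failure risk estimation
`β_{T,d} = 1 - ∑_{i=1}^d ΔΨ_d(r̃_{i-1}, r̃_i) max[0, 1 - ½ ∑_{j=1}^{i-1} ℐ(r̃_j / r̃_i)]`. -/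
def betaT {d : ℕ} (r : Fin d → ℝ) : ℝ :=
  1 - ∑ i ∈ Finset.Icc 1 d, DeltaPsi d (sorted r (i - 1)) (sorted r i) *
    max 0 (1 - 1 / 2 * ∑ j ∈ Finset.Ico 1 i, sectorI d (sorted r j / sorted r i))

/-- The real risk `β_R = 1 - ℙ(Y ⪯ 0)`. -/
def realRisk {Ω : Type*} [MeasurableSpace Ω] (P : Measure Ω) {d : ℕ}
    (Y : Ω → EuclideanSpace ℝ (Fin d)) : ℝ :=
  1 - P.real {ω | ∀ i, Y ω i ≤ 0}

end FailureRisk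

end

namespace FailureRisk

/-! Write `y = ȳ + Σ^{1/2} z` with `z` standard Gaussian. Normalizing the rows of `Σ^{1/2}` to unit
vectors `u_i` turns `y ⪯ 0` into `⟨u_i, z⟩ ≤ r_i` for all `i`. Cut space into the shells `r̃_{i-1} <
‖z‖ ≤ r̃_i`. In the `i`-th shell, Cauchy–Schwarz gives every constraint with radius at least `r̃_i`;
a violation of the `j`-th one, `j < i`, puts `z` in the cone `⟨u_j, z⟩ > (r̃_j / r̃_i) ‖z‖`, which
takes at most the share `ℐ(r̃_j / r̃_i) / 2` of the shell. A union bound in each shell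
(`DeltaPsi_mul_max_le`) and a sum over shells (`one_sub_betaT_le`) conclude.

The cone share (`stdGaussian_real_cap_le`) rests on beta–gamma algebra: `1 - z_0² / ‖z‖²` is beta
distributed and independent of `‖z‖²` (`map_normSq_share`). -/

/-! ### Beta–gamma algebra -/

/-- The factor `s` is the Jacobian of `y = s t`. The endpoints are excluded because the beta density
is set to zero there, while the gamma density at `0` need not vanish. -/
lemma mul_gammaPDF_mul_gammaPDF {a b r s t : ℝ} (ha : 0 < a) (hb : 0 < b) (hr : 0 < r)
    (hs : 0 < s) (ht0 : t ≠ 0) (ht1 : t ≠ 1) :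
    ENNReal.ofReal s * (gammaPDF a r (s - s * t) * gammaPDF b r (s * t)) =
      gammaPDF (a + b) r s * betaPDF b a t := by
  rcases lt_or_gt_of_ne ht0 with h | h
  · rw [gammaPDF_of_neg (x := s * t) (by nlinarith), betaPDF_eq_zero_of_nonpos h.le]
    simp
  rcases lt_or_gt_of_ne ht1 with h' | h'
  swap
  · rw [gammaPDF_of_neg (x := s - s * t) (by nlinarith), betaPDF_eq_zero_of_one_le h'.le]
    simp
  have h1 : 0 < 1 - t := by linarith
  rw [show s - s * t = s * (1 - t) by ring, gammaPDF_of_nonneg (by positivity),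
    gammaPDF_of_nonneg (by positivity), gammaPDF_of_nonneg hs.le, betaPDF_of_pos_lt_one h h',
    ← ENNReal.ofReal_mul (by positivity), ← ENNReal.ofReal_mul hs.le,
    ← ENNReal.ofReal_mul (by positivity)]
  congr 1
  have hexp : Real.exp (-(r * s)) = Real.exp (-(r * (s * (1 - t)))) * Real.exp (-(r * (s * t))) := by
    rw [← Real.exp_add]; ring_nf
  have hpow : s ^ (a + b - 1) = s * (s ^ (a - 1) * s ^ (b - 1)) := by
    nth_rw 2 [← Real.rpow_one s]
    rw [← Real.rpow_add hs, ← Real.rpow_add hs]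
    ring_nf
  rw [Real.mul_rpow hs.le h1.le, Real.mul_rpow hs.le h.le, hexp, hpow, Real.rpow_add hr, beta,
    add_comm b a]
  have := Real.Gamma_pos_of_pos ha
  have := Real.Gamma_pos_of_pos hb
  have := Real.Gamma_pos_of_pos (add_pos ha hb)
  field_simp

lemma measurable_gammaPDF (a r : ℝ) : Measurable (gammaPDF a r) :=
  (measurable_gammaPDFReal a r).ennreal_ofReal

lemma measurable_betaPDF (a b : ℝ) : Measurable (betaPDF a b) :=
  (measurable_betaPDFReal a b).ennreal_ofReal

lemma lintegral_eq_ofReal_mul_lintegral_comp_mul {s : ℝ} (hs : 0 < s) {g : ℝ → ENNReal}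
    (hg : Measurable g) : ∫⁻ y, g y = ENNReal.ofReal s * ∫⁻ t, g (s * t) := by
  have h := Real.map_volume_mul_left hs.ne'
  rw [← lintegral_map (f := g) (g := fun t => s * t) hg (by fun_prop), h, lintegral_smul_measure,
    smul_eq_mul, ← mul_assoc, ← ENNReal.ofReal_mul hs.le, abs_of_pos (inv_pos.2 hs),
    mul_inv_cancel₀ hs.ne']
  simp

/-- If `X ∼ Γ(a, r)` and `W ∼ Γ(b, r)` are independent, then `X + W ∼ Γ(a + b, r)` and
`W / (X + W) ∼ Beta(b, a)` are independent. -/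
theorem map_gammaMeasure_prod {a b r : ℝ} (ha : 0 < a) (hb : 0 < b) (hr : 0 < r) :
    ((gammaMeasure a r).prod (gammaMeasure b r)).map (fun p => (p.1 + p.2, p.2 / (p.1 + p.2))) =
      (gammaMeasure (a + b) r).prod (betaMeasure b a) := by
  have := isProbabilityMeasure_gammaMeasure ha hr
  have := isProbabilityMeasure_gammaMeasure hb hr
  have := isProbabilityMeasure_gammaMeasure (add_pos ha hb) hr
  have := isProbabilityMeasureBeta hb ha
  have mg := measurable_gammaPDF
  have mb := measurable_betaPDF
  refine Measure.ext_of_lintegral _ fun f hf => ?_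
  rw [lintegral_map hf (by fun_prop), lintegral_prod_symm _ (by fun_prop),
    lintegral_prod _ (by fun_prop)]
  simp only [gammaMeasure, betaMeasure]
  rw [lintegral_withDensity_eq_lintegral_mul _ (mg _ _)
      (Measurable.lintegral_prod_left' (f := fun p : ℝ × ℝ => f (p.1 + p.2, p.2 / (p.1 + p.2)))
        (by fun_prop)),
    lintegral_withDensity_eq_lintegral_mul _ (mg _ _) (Measurable.lintegral_prod_right' hf)]
  simp only [Pi.mul_apply]
  calc ∫⁻ y, gammaPDF b r y * ∫⁻ x, f (x + y, y / (x + y)) ∂volume.withDensity (gammaPDF a r)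
      = ∫⁻ y, ∫⁻ s, gammaPDF a r (s - y) * gammaPDF b r y * f (s, y / s) := by
        refine lintegral_congr fun y => ?_
        rw [lintegral_withDensity_eq_lintegral_mul _ (mg _ _) (by fun_prop),
          ← lintegral_const_mul _ (by fun_prop),
          ← lintegral_sub_right_eq_self (μ := volume) _ y]
        refine lintegral_congr fun s => ?_
        simp only [Pi.mul_apply, sub_add_cancel]
        ring
    _ = ∫⁻ s, ∫⁻ y, gammaPDF a r (s - y) * gammaPDF b r y * f (s, y / s) :=
        lintegral_lintegral_swap (Measurable.aemeasurable (by fun_prop))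
    _ = ∫⁻ s, gammaPDF (a + b) r s * ∫⁻ t, f (s, t) ∂volume.withDensity (betaPDF b a) := by
        refine lintegral_congr_ae ?_
        filter_upwards [Measure.ae_ne volume (0 : ℝ)] with s hs0
        rcases lt_or_gt_of_ne hs0 with hs | hs
        -- If `s < 0`, then `y` or `s - y` is negative, so the integrand vanishes.
        · rw [gammaPDF_of_neg hs, zero_mul, ← lintegral_zero (μ := (volume : Measure ℝ))]
          refine lintegral_congr fun y => ?_
          rcases lt_or_ge y 0 with hy | hy
          · simp [gammaPDF_of_neg hy]
          · rw [gammaPDF_of_neg (x := s - y) (by linarith)]; simp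
        · rw [lintegral_withDensity_eq_lintegral_mul _ (mb _ _) (by fun_prop),
            ← lintegral_const_mul _ (by fun_prop),
            lintegral_eq_ofReal_mul_lintegral_comp_mul hs (by fun_prop),
            ← lintegral_const_mul _ (by fun_prop)]
          refine lintegral_congr_ae ?_
          filter_upwards [Measure.ae_ne volume (0 : ℝ), Measure.ae_ne volume (1 : ℝ)] with t h0 h1
          rw [mul_div_cancel_left₀ _ hs.ne', ← mul_assoc,
            mul_gammaPDF_mul_gammaPDF ha hb hr hs h0 h1, Pi.mul_apply, mul_assoc]

lemma map_add_gammaMeasure_prod {a b r : ℝ} (ha : 0 < a) (hb : 0 < b) (hr : 0 < r) :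
    ((gammaMeasure a r).prod (gammaMeasure b r)).map (fun p => p.1 + p.2) =
      gammaMeasure (a + b) r := by
  have := isProbabilityMeasureBeta hb ha
  have := isProbabilityMeasure_gammaMeasure (add_pos ha hb) hr
  have h := congrArg (Measure.map Prod.fst) (map_gammaMeasure_prod ha hb hr)
  rw [Measure.map_map (by fun_prop) (by fun_prop), Measure.map_fst_prod] at h
  simpa [Function.comp_def] using h

/-! ### Squares of Gaussians and the chi-squared law -/

lemma gaussianPDF_neg (x : ℝ) : gaussianPDF 0 1 (-x) = gaussianPDF 0 1 x := by
  simp [gaussianPDF, gaussianPDFReal]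

lemma two_mul_gaussianPDF {x : ℝ} (hx : 0 < x) :
    2 * gaussianPDF 0 1 x = ENNReal.ofReal |2 * x| * gammaPDF (1 / 2) (1 / 2) (x ^ 2) := by
  rw [gammaPDF_of_nonneg (by positivity), gaussianPDF, gaussianPDFReal,
    ← ENNReal.ofReal_mul (by positivity), abs_of_pos (by positivity),
    show (2 : ENNReal) = ENNReal.ofReal 2 by simp, ← ENNReal.ofReal_mul (by positivity)]
  congr 1
  rw [← Real.rpow_natCast x 2, ← Real.rpow_mul hx.le, Real.Gamma_one_half_eq,
    ← Real.sqrt_eq_rpow (1 / 2)]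
  norm_num [Real.rpow_neg_one]
  field_simp

/-- The square of a standard normal variable follows the law `Γ(1/2, 1/2)`. -/
theorem map_sq_gaussianReal :
    (gaussianReal 0 1).map (fun x => x ^ 2) = gammaMeasure (1 / 2) (1 / 2) := by
  have mg := measurable_gammaPDF (1 / 2) (1 / 2)
  have mn := measurable_gaussianPDF 0 1
  refine Measure.ext_of_lintegral _ fun f hf => ?_
  rw [lintegral_map hf (by fun_prop), gaussianReal_of_var_ne_zero _ one_ne_zero, gammaMeasure,
    lintegral_withDensity_eq_lintegral_mul _ mn (by fun_prop),
    lintegral_withDensity_eq_lintegral_mul _ mg hf]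
  simp only [Pi.mul_apply]
  have hneg : ∫⁻ x in Set.Iio 0, gaussianPDF 0 1 x * f (x ^ 2) =
      ∫⁻ x in Set.Ioi 0, gaussianPDF 0 1 x * f (x ^ 2) := by
    rw [← (Measure.measurePreserving_neg (volume : Measure ℝ)).setLIntegral_comp_preimage
      measurableSet_Iio (by fun_prop)]
    simp [gaussianPDF_neg]
  have himage : (fun x : ℝ => x ^ 2) '' Set.Ioi 0 = Set.Ioi 0 := by
    ext y
    constructor
    · rintro ⟨x, hx, rfl⟩
      exact pow_pos (Set.mem_Ioi.1 hx) 2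
    · intro hy
      exact ⟨√y, Real.sqrt_pos.2 hy, Real.sq_sqrt (le_of_lt hy)⟩
  have hsplit : ∀ g : ℝ → ENNReal,
      ∫⁻ x, g x = (∫⁻ x in Set.Iio 0, g x) + ∫⁻ x in Set.Ioi 0, g x := fun g => by
    rw [← lintegral_add_compl _ measurableSet_Iio, Set.compl_Iio,
      setLIntegral_congr Ioi_ae_eq_Ici]
  rw [hsplit, hneg, hsplit (fun x => gammaPDF (1 / 2) (1 / 2) x * f x),
    setLIntegral_congr_fun (g := fun _ => 0) measurableSet_Iio
      (fun x hx => by simp [gammaPDF_of_neg (Set.mem_Iio.1 hx)]), lintegral_zero, zero_add,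
    ← two_mul, ← lintegral_const_mul _ (by fun_prop)]
  conv_rhs => rw [← himage]
  rw [lintegral_image_eq_lintegral_abs_deriv_mul (f' := fun x => 2 * x) measurableSet_Ioi
    (fun x _ => by simpa using (hasDerivAt_pow 2 x).hasDerivWithinAt)
    (fun x hx y hy h => by
      exact (pow_left_inj₀ (le_of_lt hx) (le_of_lt hy) two_ne_zero).1 h)]
  refine setLIntegral_congr_fun measurableSet_Ioi fun x hx => ?_
  rw [← mul_assoc, two_mul_gaussianPDF hx, mul_assoc]

lemma map_chiSquared_prod (n : ℕ) :
    (Measure.pi (fun _ : Fin (n + 1) => gaussianReal 0 1)).map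
      (fun z => (z 0 ^ 2, ∑ i : Fin n, z i.succ ^ 2)) =
    (gammaMeasure (1 / 2) (1 / 2)).prod (chiSquared n) := by
  have h := (measurePreserving_piFinSuccAbove (fun _ : Fin (n + 1) => gaussianReal 0 1) 0).map_eq
  rw [← map_sq_gaussianReal, chiSquared, Measure.map_prod_map _ _ (by fun_prop) (by fun_prop),
    ← h, Measure.map_map (by fun_prop) (by fun_prop)]
  rfl

/-- The chi-squared distribution with `n + 1` degrees of freedom is `Γ((n + 1) / 2, 1 / 2)`. -/
theorem chiSquared_succ (n : ℕ) :
    chiSquared (n + 1) = gammaMeasure (((n + 1 : ℕ) : ℝ) / 2) (1 / 2) := by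
  have key : ∀ n, chiSquared (n + 1) =
      ((gammaMeasure (1 / 2) (1 / 2)).prod (chiSquared n)).map (fun p => p.1 + p.2) := fun n => by
    rw [← map_chiSquared_prod, Measure.map_map (by fun_prop) (by fun_prop), chiSquared]
    congr 1
    ext z
    simp [Fin.sum_univ_succ]
  induction n with
  | zero =>
    -- The empty sum is a Dirac mass, not a gamma law, so the induction starts at one degree of
    -- freedom.
    have h0 : chiSquared 0 = Measure.dirac 0 := by
      simp [chiSquared, Measure.map_const]
    have := isProbabilityMeasure_gammaMeasure (a := 1 / 2) (r := 1 / 2) (by simp) (by simp)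
    rw [key, h0, Measure.prod_dirac, Measure.map_map (by fun_prop) (by fun_prop)]
    simp [Function.comp_def]
  | succ n ih =>
    rw [key, ih, map_add_gammaMeasure_prod (by simp) (by positivity) (by simp)]
    congr 1
    push_cast
    ring

/-- The squared norm of a standard Gaussian vector is chi-squared, and independent of the share of
all coordinates but the first, which follows a beta distribution. -/
theorem map_normSq_share (n : ℕ) :
    (Measure.pi (fun _ : Fin (n + 2) => gaussianReal 0 1)).map
      (fun z => (∑ i, z i ^ 2, (∑ i : Fin (n + 1), z i.succ ^ 2) / ∑ i, z i ^ 2)) =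
    (chiSquared (n + 2)).prod (betaMeasure (((n + 1 : ℕ) : ℝ) / 2) (1 / 2)) := by
  have h := map_gammaMeasure_prod (a := 1 / 2) (b := ((n + 1 : ℕ) : ℝ) / 2) (r := 1 / 2)
    (by simp) (by positivity) (by simp)
  rw [← chiSquared_succ, ← map_chiSquared_prod, Measure.map_map (by fun_prop) (by fun_prop)] at h
  rw [chiSquared_succ]
  convert h using 2
  · ext z <;> simp [Fin.sum_univ_succ]
  · congr 1
    push_cast
    ring

/-! ### Gaussian measure of cones and shells -/

/-- The regularized incomplete beta function is the distribution function of the beta law. -/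
lemma betaMeasure_real_Iio {a b x : ℝ} (ha : 0 < a) (hb : 0 < b) (hx0 : 0 ≤ x) (hx1 : x ≤ 1) :
    (betaMeasure a b).real (Set.Iio x) = regIncBeta x a b := by
  have hnn : ∀ t, 0 ≤ betaPDFReal a b t := fun t => by
    by_cases h : 0 < t ∧ t < 1
    · exact (betaPDFReal_pos h.1 h.2 ha hb).le
    · simp [betaPDFReal, h]
  rw [betaMeasure, measureReal_def, withDensity_apply _ measurableSet_Iio, regIncBeta]
  simp only [betaPDF]
  rw [← integral_eq_lintegral_of_nonneg_ae (ae_of_all _ hnn) (by fun_prop),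
    ← intervalIntegral.integral_const_mul, intervalIntegral.integral_of_le hx0,
    integral_Ioc_eq_integral_Ioo,
    setIntegral_eq_of_subset_of_forall_sdiff_eq_zero measurableSet_Iio
      (s := Set.Ioo 0 x) Set.Ioo_subset_Iio_self]
  · refine setIntegral_congr_fun measurableSet_Ioo fun t ht => ?_
    simp only [betaPDFReal]
    rw [if_pos ⟨ht.1, ht.2.trans_le hx1⟩, mul_assoc]
  · rintro t ⟨h1, h2⟩
    rw [betaPDFReal, if_neg]
    exact fun h => h2 ⟨h.1, h1⟩

instance isProbabilityMeasure_chiSquared (d : ℕ) : IsProbabilityMeasure (chiSquared d) :=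
  Measure.isProbabilityMeasure_map (Measurable.aemeasurable (by fun_prop))

lemma map_norm_sq_stdGaussian (d : ℕ) :
    (stdGaussian (EuclideanSpace ℝ (Fin d))).map (fun z => ‖z‖ ^ 2) = chiSquared d := by
  rw [← map_pi_eq_stdGaussian, Measure.map_map (by fun_prop) (by fun_prop), chiSquared]
  congr 1
  ext z
  simp [EuclideanSpace.real_norm_sq_eq]

lemma exists_orthonormalBasis_apply_zero {n : ℕ} {u : EuclideanSpace ℝ (Fin (n + 1))}
    (hu : ‖u‖ = 1) :
    ∃ b : OrthonormalBasis (Fin (n + 1)) ℝ (EuclideanSpace ℝ (Fin (n + 1))), b 0 = u := by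
  obtain ⟨b, hb⟩ := Orthonormal.exists_orthonormalBasis_extension_of_card_eq (𝕜 := ℝ)
    (E := EuclideanSpace ℝ (Fin (n + 1))) (ι := Fin (n + 1)) (by simp)
    (v := fun _ => u) (s := {0}) (by
      rw [orthonormal_iff_ite]
      rintro ⟨i, rfl⟩ ⟨j, rfl⟩
      simp [hu])
  exact ⟨b, hb 0 rfl⟩

/-- By rotation invariance `u` may be taken as the first axis; the double cone then says that the
share of the other coordinates is below `1 - c²`. -/
lemma stdGaussian_real_double_cap_le {n : ℕ} {u : EuclideanSpace ℝ (Fin (n + 2))} (hu : ‖u‖ = 1)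
    (c : ℝ) {B : Set ℝ} (hB : MeasurableSet B) :
    (stdGaussian (EuclideanSpace ℝ (Fin (n + 2)))).real
      {z | c ^ 2 * ‖z‖ ^ 2 < inner ℝ u z ^ 2 ∧ ‖z‖ ^ 2 ∈ B} ≤
    (chiSquared (n + 2)).real B *
      (betaMeasure (((n + 1 : ℕ) : ℝ) / 2) (1 / 2)).real (Set.Iio (1 - c ^ 2)) := by
  obtain ⟨b, rfl⟩ := exists_orthonormalBasis_apply_zero hu
  have := isProbabilityMeasureBeta (α := ((n + 1 : ℕ) : ℝ) / 2) (β := 1 / 2)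
    (by positivity) (by simp)
  have hmeas : MeasurableSet {z : EuclideanSpace ℝ (Fin (n + 2)) |
      c ^ 2 * ‖z‖ ^ 2 < inner ℝ (b 0) z ^ 2 ∧ ‖z‖ ^ 2 ∈ B} :=
    MeasurableSet.inter (measurableSet_lt (f := fun z => c ^ 2 * ‖z‖ ^ 2)
      (g := fun z => inner ℝ (b 0) z ^ 2) (by fun_prop) (by fun_prop))
      (hB.preimage (f := fun z => ‖z‖ ^ 2) (by fun_prop))
  rw [stdGaussian_eq_map_pi_orthonormalBasis b, map_measureReal_apply (by fun_prop) hmeas,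
    ← measureReal_prod_prod, ← map_normSq_share,
    map_measureReal_apply (by fun_prop) (hB.prod measurableSet_Iio)]
  refine measureReal_mono ?_ (measure_ne_top _ _)
  rintro z ⟨h1, h2⟩
  have hnorm : ‖∑ i, z i • b i‖ ^ 2 = ∑ i, z i ^ 2 := by
    rw [← b.sum_sq_inner_right]
    simp [b.orthonormal.inner_right_fintype]
  have hinner : inner ℝ (b 0) (∑ i, z i • b i) = z 0 := by
    simp [b.orthonormal.inner_right_fintype]
  rw [hnorm] at h1 h2
  rw [hinner] at h1
  refine ⟨h2, ?_⟩
  have hnn : 0 ≤ ∑ i : Fin (n + 1), z i.succ ^ 2 := Finset.sum_nonneg fun i _ => sq_nonneg _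
  simp only [Fin.sum_univ_succ (n := n + 1), Set.mem_Iio] at h1 ⊢
  have hpos : 0 < z 0 ^ 2 := lt_of_le_of_lt (by positivity) h1
  rw [div_lt_iff₀ (by positivity)]
  linarith

/-- The part of a shell around the origin that lies in a cone of half-angle `arccos c` has at most
the Gaussian measure of the shell times the sector fraction `ℐ(c) / 2`. -/
theorem stdGaussian_real_cap_le {d : ℕ} (hd : 2 ≤ d) {u : EuclideanSpace ℝ (Fin d)}
    (hu : ‖u‖ = 1) {c : ℝ} (hc0 : 0 ≤ c) (hc1 : c ≤ 1) {B : Set ℝ} (hB : MeasurableSet B) :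
    (stdGaussian (EuclideanSpace ℝ (Fin d))).real {z | c * ‖z‖ < inner ℝ u z ∧ ‖z‖ ^ 2 ∈ B} ≤
      (chiSquared d).real B * (1 / 2 * sectorI d c) := by
  obtain ⟨n, rfl⟩ := Nat.exists_eq_add_of_le' hd
  set μ := stdGaussian (EuclideanSpace ℝ (Fin (n + 2)))
  have hmeas : ∀ v, MeasurableSet {z : EuclideanSpace ℝ (Fin (n + 2)) |
      c * ‖z‖ < inner ℝ v z ∧ ‖z‖ ^ 2 ∈ B} := fun v =>
    MeasurableSet.inter (measurableSet_lt (f := fun z => c * ‖z‖) (g := fun z => inner ℝ v z)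
      (by fun_prop) (by fun_prop)) (hB.preimage (f := fun z => ‖z‖ ^ 2) (by fun_prop))
  have hneg : μ.real {z | c * ‖z‖ < inner ℝ (-u) z ∧ ‖z‖ ^ 2 ∈ B} =
      μ.real {z | c * ‖z‖ < inner ℝ u z ∧ ‖z‖ ^ 2 ∈ B} := by
    conv_lhs => rw [show μ = stdGaussian _ from rfl,
      ← stdGaussian_map (LinearIsometryEquiv.neg ℝ (E := EuclideanSpace ℝ (Fin (n + 2)))),
      map_measureReal_apply (by fun_prop) (hmeas _)]
    simp [μ]
  -- As `c ≥ 0`, the cones around `u` and `-u` are disjoint; they have equal measure, so each has at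
  -- most half of the double cone.
  have hunion := measureReal_union (μ := μ)
    (s₁ := {z | c * ‖z‖ < inner ℝ u z ∧ ‖z‖ ^ 2 ∈ B})
    (s₂ := {z | c * ‖z‖ < inner ℝ (-u) z ∧ ‖z‖ ^ 2 ∈ B})
    (Set.disjoint_left.2 fun z h h' => by
      have h1 := h.1
      have h2 := h'.1
      rw [inner_neg_left] at h2
      have : 0 ≤ c * ‖z‖ := by positivity
      linarith) (hmeas _)
  have hle : μ.real ({z | c * ‖z‖ < inner ℝ u z ∧ ‖z‖ ^ 2 ∈ B} ∪
      {z | c * ‖z‖ < inner ℝ (-u) z ∧ ‖z‖ ^ 2 ∈ B}) ≤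
      μ.real {z | c ^ 2 * ‖z‖ ^ 2 < inner ℝ u z ^ 2 ∧ ‖z‖ ^ 2 ∈ B} := by
    refine measureReal_mono ?_ (measure_ne_top _ _)
    rintro z (h | h)
    · refine ⟨?_, h.2⟩
      rw [← mul_pow]
      exact pow_lt_pow_left₀ h.1 (by positivity) two_ne_zero
    · refine ⟨?_, h.2⟩
      rw [← mul_pow, ← neg_sq (inner ℝ u z), ← inner_neg_left]
      exact pow_lt_pow_left₀ h.1 (by positivity) two_ne_zero
  have hcap := stdGaussian_real_double_cap_le hu c hB
  rw [betaMeasure_real_Iio (by positivity) (by simp) (by nlinarith) (by nlinarith)] at hcap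
  have hsec : sectorI (n + 2) c = regIncBeta (1 - c ^ 2) (((n + 1 : ℕ) : ℝ) / 2) (1 / 2) := by
    rw [sectorI]
    congr 1
    push_cast
    ring
  rw [hsec]
  linarith

/-! ### Shells and the union bound -/

lemma DeltaPsi_eq_chiSquared_real_Ioc (d : ℕ) {r s : ℝ} (hr : 0 ≤ r) (hrs : r ≤ s) :
    DeltaPsi d r s = (chiSquared d).real (Set.Ioc (r ^ 2) (s ^ 2)) := by
  have hsq : r ^ 2 ≤ s ^ 2 := by gcongr
  rw [DeltaPsi, Psi, Psi, if_pos hr, if_pos (hr.trans hrs), Phi, Phi, cdf_eq_real, cdf_eq_real,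
    ← Set.Iic_sdiff_Iic, measureReal_sdiff (Set.Iic_subset_Iic.2 hsq) measurableSet_Iic]
  ring

lemma sorted_of_mem {d : ℕ} (r : Fin d → ℝ) {k : ℕ} (h : 1 ≤ k ∧ k ≤ d) :
    sorted r k = r (Tuple.sort r ⟨k - 1, by omega⟩) := by
  rw [sorted, dif_pos h]

lemma sorted_nonneg {d : ℕ} {r : Fin d → ℝ} (hr : ∀ i, 0 ≤ r i) (k : ℕ) : 0 ≤ sorted r k := by
  unfold sorted
  split_ifs
  · exact hr _
  · exact le_rfl

/-- Nonnegativity makes `r̃_0 = 0` fit the order; `k ≤ d` avoids the default value `0`. -/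
lemma sorted_mono {d : ℕ} {r : Fin d → ℝ} (hr : ∀ i, 0 ≤ r i) {j k : ℕ} (hjk : j ≤ k)
    (hk : k ≤ d) : sorted r j ≤ sorted r k := by
  rcases Nat.eq_zero_or_pos j with rfl | hj
  · simpa [sorted] using sorted_nonneg hr k
  · rw [sorted_of_mem r ⟨hj, hjk.trans hk⟩, sorted_of_mem r ⟨hj.trans_le hjk, hk⟩]
    exact Tuple.monotone_sort r (Fin.mk_le_mk.2 (by omega))

/-- The shell between two consecutive radii, cut by the half-spaces whose boundaries are at least
as far as its outer radius, loses at most the sectors of the nearer half-spaces. -/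
lemma DeltaPsi_mul_max_le {d : ℕ} {u : Fin d → EuclideanSpace ℝ (Fin d)} (hu : ∀ i, ‖u i‖ = 1)
    {r : Fin d → ℝ} (hr : ∀ i, 0 ≤ r i) {i : ℕ} (hi1 : 1 ≤ i) (hid : i ≤ d) :
    DeltaPsi d (sorted r (i - 1)) (sorted r i) *
      max 0 (1 - 1 / 2 * ∑ j ∈ Finset.Ico 1 i, sectorI d (sorted r j / sorted r i)) ≤
    (stdGaussian (EuclideanSpace ℝ (Fin d))).real ({z | ∀ m, inner ℝ (u m) z ≤ r m} ∩
      {z | ‖z‖ ^ 2 ∈ Set.Ioc (sorted r (i - 1) ^ 2) (sorted r i ^ 2)}) := by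
  set μ := stdGaussian (EuclideanSpace ℝ (Fin d))
  rw [DeltaPsi_eq_chiSquared_real_Ioc d (sorted_nonneg hr _) (sorted_mono hr (by omega) hid)]
  set B := Set.Ioc (sorted r (i - 1) ^ 2) (sorted r i ^ 2)
  rcases le_total (1 - 1 / 2 * ∑ j ∈ Finset.Ico 1 i, sectorI d (sorted r j / sorted r i)) 0
    with h | h
  · rw [max_eq_left h, mul_zero]
    exact measureReal_nonneg
  rw [max_eq_right h]
  let v : ℕ → EuclideanSpace ℝ (Fin d) := fun k =>
    if h : 1 ≤ k ∧ k ≤ d then u (Tuple.sort r ⟨k - 1, by omega⟩) else 0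
  have hv : ∀ k, 1 ≤ k ∧ k ≤ d → ‖v k‖ = 1 := fun k hk => by simp only [v, dif_pos hk, hu]
  let C : ℕ → Set (EuclideanSpace ℝ (Fin d)) := fun k =>
    {z | sorted r k / sorted r i * ‖z‖ < inner ℝ (v k) z ∧ ‖z‖ ^ 2 ∈ B}
  have hcap : ∀ k ∈ Finset.Ico 1 i,
      μ.real (C k) ≤ (chiSquared d).real B * (1 / 2 * sectorI d (sorted r k / sorted r i)) := by
    intro k hk
    rw [Finset.mem_Ico] at hk
    -- A nearer half-space exists only if `1 ≤ k < i ≤ d`, which forces `d ≥ 2`.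
    exact stdGaussian_real_cap_le (by omega) (hv k ⟨hk.1, by omega⟩)
      (div_nonneg (sorted_nonneg hr _) (sorted_nonneg hr _))
      (div_le_one_of_le₀ (sorted_mono hr hk.2.le hid) (sorted_nonneg hr _)) measurableSet_Ioc
  have hcover : {z : EuclideanSpace ℝ (Fin d) | ‖z‖ ^ 2 ∈ B} ⊆
      ({z | ∀ m, inner ℝ (u m) z ≤ r m} ∩ {z | ‖z‖ ^ 2 ∈ B}) ∪ ⋃ k ∈ Finset.Ico 1 i, C k := by
    intro z hz
    by_cases hA : ∀ m, inner ℝ (u m) z ≤ r m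
    · exact Or.inl ⟨hA, hz⟩
    right
    push Not at hA
    obtain ⟨m, hm⟩ := hA
    obtain ⟨q, rfl⟩ := (Tuple.sort r).surjective m
    have hq : 1 ≤ (q : ℕ) + 1 ∧ (q : ℕ) + 1 ≤ d := ⟨by omega, q.2⟩
    have hR : sorted r (q + 1) = r (Tuple.sort r q) := sorted_of_mem r hq
    have hvq : v (q + 1) = u (Tuple.sort r q) := dif_pos hq
    have hzR : ‖z‖ ≤ sorted r i := le_of_sq_le_sq hz.2 (sorted_nonneg hr _)
    have hinner : inner ℝ (u (Tuple.sort r q)) z ≤ ‖z‖ := by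
      simpa [hu] using real_inner_le_norm (u (Tuple.sort r q)) z
    -- Otherwise `r̃_i ≤ r̃_{q+1} < ⟨u, z⟩ ≤ ‖z‖ ≤ r̃_i`.
    have hqi : (q : ℕ) + 1 < i := by
      by_contra hcon
      have := sorted_mono hr (not_lt.1 hcon) hq.2
      linarith
    refine Set.mem_biUnion (x := (q : ℕ) + 1) (by simp [hqi]) ⟨?_, hz⟩
    rw [hvq]
    refine lt_of_le_of_lt ?_ (hR ▸ hm)
    -- The bound `(r̃_{q+1} / r̃_i) ‖z‖ ≤ r̃_{q+1}` also holds when `r̃_i = 0`, where the quotient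
    -- is `0`.
    rw [div_mul_eq_mul_div]
    exact div_le_of_le_mul₀ (sorted_nonneg hr _) (sorted_nonneg hr _)
      (mul_le_mul_of_nonneg_left hzR (sorted_nonneg hr _))
  have hshell : μ.real {z | ‖z‖ ^ 2 ∈ B} = (chiSquared d).real B := by
    rw [← map_norm_sq_stdGaussian, map_measureReal_apply (by fun_prop) measurableSet_Ioc]
    rfl
  have h1 := (measureReal_mono hcover (measure_ne_top μ _)).trans (measureReal_union_le _ _)
  have h2 := (measureReal_biUnion_finset_le (μ := μ) (Finset.Ico 1 i) C).trans
    (Finset.sum_le_sum hcap)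
  rw [← Finset.mul_sum, ← Finset.mul_sum] at h2
  rw [hshell] at h1
  linarith

/-- Lower bound for the Gaussian measure of an intersection of half-spaces containing the origin. -/
theorem one_sub_betaT_le {d : ℕ} {u : Fin d → EuclideanSpace ℝ (Fin d)} (hu : ∀ i, ‖u i‖ = 1)
    {r : Fin d → ℝ} (hr : ∀ i, 0 ≤ r i) :
    1 - betaT r ≤
      (stdGaussian (EuclideanSpace ℝ (Fin d))).real {z | ∀ m, inner ℝ (u m) z ≤ r m} := by
  rw [betaT, sub_sub_cancel]
  have hA : MeasurableSet {z : EuclideanSpace ℝ (Fin d) | ∀ m, inner ℝ (u m) z ≤ r m} := by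
    rw [Set.ofPred_forall]
    exact MeasurableSet.iInter fun m => measurableSet_le (by fun_prop) (by fun_prop)
  refine (Finset.sum_le_sum fun i hi => DeltaPsi_mul_max_le hu hr (Finset.mem_Icc.1 hi).1
    (Finset.mem_Icc.1 hi).2).trans ?_
  rw [← measureReal_biUnion_finset]
  -- The region beyond `r̃_d` is simply discarded.
  · exact measureReal_mono (Set.iUnion₂_subset fun i _ => Set.inter_subset_left)
      (measure_ne_top _ _)
  · have key : ∀ i j : ℕ, i < j → j ≤ d → ∀ z : EuclideanSpace ℝ (Fin d),
        ‖z‖ ^ 2 ≤ sorted r i ^ 2 → sorted r (j - 1) ^ 2 < ‖z‖ ^ 2 → False := by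
      intro i j hij hj z h1 h2
      have h3 : sorted r i ^ 2 ≤ sorted r (j - 1) ^ 2 :=
        pow_le_pow_left₀ (sorted_nonneg hr _) (sorted_mono hr (by omega) (by omega)) 2
      linarith
    intro i hi j hj hij
    simp only [Finset.coe_Icc, Set.mem_Icc] at hi hj
    refine Set.disjoint_left.2 fun z hz hz' => ?_
    rcases lt_or_gt_of_ne hij with h | h
    · exact key i j h hj.2 z hz.2.2 hz'.2.1
    · exact key j i h hi.2 z hz'.2.2 hz.2.1
  · exact fun i _ => hA.inter (measurableSet_Ioc.preimage (by fun_prop))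

/-! ### Reduction to the standard Gaussian -/

open scoped MatrixOrder in
-- The square root is symmetric, so a diagonal entry of its square is a sum of squares along a row.
lemma norm_sq_row_sqrt {d : ℕ} {S : Matrix (Fin d) (Fin d) ℝ} (hS : S.PosSemidef) (i : Fin d) :
    ‖WithLp.toLp 2 (CFC.sqrt S i)‖ ^ 2 = S i i := by
  have hherm : (CFC.sqrt S).IsHermitian := (CFC.sqrt_nonneg S).isSelfAdjoint
  conv_rhs => rw [← CFC.sqrt_mul_sqrt_self S hS.nonneg]
  rw [EuclideanSpace.real_norm_sq_eq, Matrix.mul_apply]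
  refine Finset.sum_congr rfl fun k _ => ?_
  rw [sq, ← hherm.apply k i]
  simp

end FailureRisk

open scoped MatrixOrder in
theorem mainTheorem1 {Ω : Type*} [MeasurableSpace Ω] (P : Measure Ω) [IsProbabilityMeasure P]
    (d : ℕ) (hd : 1 ≤ d)
    (ybar : EuclideanSpace ℝ (Fin d)) (S : Matrix (Fin d) (Fin d) ℝ)
    (hS : S.PosSemidef) (hdiag : ∀ i, 0 < S i i)
    (Y : Ω → EuclideanSpace ℝ (Fin d))
    (hY : HasLaw Y (multivariateGaussian ybar S) P)
    (hybar : ∀ i, ybar i ≤ 0) :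
    FailureRisk.realRisk P Y ≤ FailureRisk.betaT (FailureRisk.signedDist ybar S) := by
  have hσ : ∀ i, 0 < √(S i i) := fun i => Real.sqrt_pos.2 (hdiag i)
  let a : Fin d → EuclideanSpace ℝ (Fin d) := fun i => WithLp.toLp 2 (CFC.sqrt S i)
  have ha : ∀ i, ‖a i‖ = √(S i i) := fun i => by
    rw [← FailureRisk.norm_sq_row_sqrt hS i, Real.sqrt_sq (norm_nonneg _)]
  have hu : ∀ i, ‖(√(S i i))⁻¹ • a i‖ = 1 := fun i => by
    rw [norm_smul, ha, Real.norm_of_nonneg (inv_nonneg.2 (hσ i).le), inv_mul_cancel₀ (hσ i).ne']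
  have hr : ∀ i, 0 ≤ FailureRisk.signedDist ybar S i := fun i =>
    div_nonneg (neg_nonneg.2 (hybar i)) (hσ i).le
  have key := FailureRisk.one_sub_betaT_le hu hr
  have hA : MeasurableSet {y : EuclideanSpace ℝ (Fin d) | ∀ i, y i ≤ 0} := by
    rw [Set.ofPred_forall]
    exact MeasurableSet.iInter fun m => measurableSet_le (by fun_prop) (by fun_prop)
  have hP : P.real {ω | ∀ i, Y ω i ≤ 0} = (stdGaussian (EuclideanSpace ℝ (Fin d))).real
      {z | ∀ i, inner ℝ ((√(S i i))⁻¹ • a i) z ≤ FailureRisk.signedDist ybar S i} := by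
    have h1 : P.real {ω | ∀ i, Y ω i ≤ 0} =
        (multivariateGaussian ybar S).real {y | ∀ i, y i ≤ 0} := by
      rw [← hY.map_eq, measureReal_def, measureReal_def, Measure.map_apply_of_aemeasurable
        hY.aemeasurable hA]
      rfl
    rw [h1, multivariateGaussian, map_measureReal_apply (by fun_prop) hA]
    congr 1
    ext z
    simp only [Set.mem_preimage, Set.mem_ofPred_eq]
    refine forall_congr' fun i => ?_
    have hrow : Matrix.toEuclideanCLM (𝕜 := ℝ) (CFC.sqrt S) z i = inner ℝ (a i) z := by
      simp [a, PiLp.inner_apply, Matrix.mulVec, dotProduct, mul_comm]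
    rw [PiLp.add_apply, hrow, real_inner_smul_left, FailureRisk.signedDist,
      le_div_iff₀ (hσ i), mul_comm, mul_inv_cancel_left₀ (hσ i).ne']
    constructor <;> intro h <;> linarith
  rw [FailureRisk.realRisk, hP]
  linarith
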